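/- Let $n\ge 3$, let $k$ be an algebraically closed field, let $\mathcal C$ be an additive $k$-linear category with split idempotents, and let $\Sigma:\mathcal C\to\mathcal C$ be a $k$-linear automorphism. Let $\operatorname{mod}\mathcal C$ be the category of finitely presented contravariant functors from $\mathcal C$ to $k$-modules, and extend $\Sigma$ to it by $\Sigma M=M\circ\Sigma^{-1}$. The category $\mathcal C$ is identified, by the Yoneda embedding, with the full subcategory $\operatorname{proj}\mathcal C$ of projective objects of $\operatorname{mod}\mathcal C$. Assume that $\operatorname{mod}\mathcal C$ is an abelian Frobenius category (enough projectives, enough injectives, and projectives coincide with injectives) and that there is an exact sequence of exact endofunctors of $\operatorname{mod}\mathcal C$ $$0\to \mathrm{Id}\xrightarrow{\iota} X^1\to X^2\to\cdots\to X^n\xrightarrow{\pi}\Sigma\to 0\qquad(\ast)$$ in which all $X^i$ take values in $\operatorname{proj}\mathcal C$. An *$n$-$\Sigma$-sequence* is a sequence $X_1\xrightarrow{f_1}X_2\to\cdots\to X_n\xrightarrow{f_n}\Sigma X_1$. An *$n$-$\Sigma$-complex* in $\mathcal C$ is an $n$-$\Sigma$-sequence in $\mathcal C$ that is exact, i.e.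 for which $\cdots\to\mathcal C(-,X_1)\to\cdots\to\mathcal C(-,X_n)\to\mathcal C(-,\Sigma X_1)\to\cdots$ is exact; it is continued $\Sigma$-periodically to an acyclic complex. Morphisms and homotopies of $n$-$\Sigma$-sequences are the $\Sigma$-periodic ones. For $M\in\operatorname{mod}\mathcal C$ the *standard $n$-angle* $T_M$ is $$X^1M\to X^2M\to\cdots\to X^nM\xrightarrow{\ \Sigma(\iota_M)\,\pi_M\ }\Sigma X^1M .$$ Fix for each $M\in\operatorname{mod}\mathcal C$ a short exact sequence $0\to M\to I_M\to\Omega^{-1}M\to0$ with $I_M\in\operatorname{proj}\mathcal C$; splicing gives exact sequences $0\to M\to I_M\to I_{\Omega^{-1}M}\to\cdots\to I_{\Omega^{1-n}M}\to\Omega^{-n}M\to 0$. Let $\alpha_M:\Sigma M\to\Omega^{-n}M$ be the morphism of the stable category $\underline{\operatorname{mod}}\,\mathcal C$ (morphisms modulo those factoring through projectives) induced by a map over $\mathrm{id}_M$ from the value of $(\ast)$ at $M$ to this sequence. If $X_\bullet$ is an $n$-$\Sigma$-complex and $M=\ker f_1\xrightarrow{\,l\,}X_1$ is the kernel in $\operatorname{mod}\mathcal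 C$, then $f_n$ factors as $X_n\twoheadrightarrow\Sigma M\xrightarrow{\Sigma l}\Sigma X_1$; let $\beta_M:\Sigma M\to\Omega^{-n}M$ be the morphism of $\underline{\operatorname{mod}}\,\mathcal C$ induced in the same way by the exact sequence $0\to M\to X_1\to\cdots\to X_n\to\Sigma M\to0$. Call $X_\bullet$ a *$\Phi$-$n$-$\Sigma$-complex* if $\beta_{\ker f_1}=\alpha_{\ker f_1}$ in $\underline{\operatorname{mod}}\,\mathcal C$. **Proposition 2.5.** An $n$-$\Sigma$-complex $X_\bullet$ in $\mathcal C$ is a $\Phi$-$n$-$\Sigma$-complex if and only if there is an $M\in\operatorname{mod}\mathcal C$ such that $X_\bullet$ is homotopy equivalent to $T_M$ via $n$-$\Sigma$-periodic morphisms and homotopies. In particular, the category of $\Phi$-$n$-$\Sigma$-complexes is equivalent (compatibly with the inclusions into the category of $n$-$\Sigma$-complexes) to the category of $n$-$\Sigma$-complexes that are homotopy equivalent to standard $n$-angles. -/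

import Mathlib

open CategoryTheory CategoryTheory.Limits Opposite

universe w v u v₁ u₁ v₂ u₂

namespace NAngle

/-! ### `n`-`Σ`-sequences

Throughout, `n = r + 2` for a natural number `r`, and the terms `X₁, …, Xₙ` of a sequence are
numbered `0, …, r + 1`. -/

section Sequences

variable {D : Type u₁} [Category.{v₁} D]

/-- An `(r + 2)`-`S`-sequence `X 0 ⟶ X 1 ⟶ ⋯ ⟶ X (r + 1) ⟶ S (X 0)` in the category `D` with
endofunctor `S`: the arrows are `d 0, …, d r` and `last`. -/
structure NSeq (S : D ⥤ D) (r : ℕ) where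
  X : Fin (r + 2) → D
  d : ∀ (i : ℕ) (h : i < r + 1), X ⟨i, Nat.lt_succ_of_lt h⟩ ⟶ X ⟨i + 1, Nat.succ_lt_succ h⟩
  last : X ⟨r + 1, Nat.lt_succ_self _⟩ ⟶ S.obj (X ⟨0, Nat.succ_pos _⟩)

variable {S : D ⥤ D} {r : ℕ}

/-- The (`S`-periodic) morphisms of `(r + 2)`-`S`-sequences. -/
@[ext]
structure NSeq.Hom (X Y : NSeq S r) where
  φ : ∀ i, X.X i ⟶ Y.X i
  comm : ∀ (i : ℕ) (h : i < r + 1),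
    X.d i h ≫ φ ⟨i + 1, Nat.succ_lt_succ h⟩ = φ ⟨i, Nat.lt_succ_of_lt h⟩ ≫ Y.d i h
  comm_last : X.last ≫ S.map (φ ⟨0, Nat.succ_pos _⟩) = φ ⟨r + 1, Nat.lt_succ_self _⟩ ≫ Y.last

instance : Category (NSeq S r) where
  Hom X Y := NSeq.Hom X Y
  id X :=
    { φ := fun _ => 𝟙 _
      comm := by intro i h; simp
      comm_last := by rw [S.map_id, Category.comp_id, Category.id_comp] }
  comp f g :=
    { φ := fun i => f.φ i ≫ g.φ i
      comm := by
        intro i h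
        rw [← Category.assoc, f.comm, Category.assoc, g.comm, Category.assoc]
      comm_last := by
        rw [S.map_comp, ← Category.assoc, f.comm_last, Category.assoc, g.comm_last,
          Category.assoc] }
  id_comp f := NSeq.Hom.ext (funext fun _ => Category.id_comp _)
  comp_id f := NSeq.Hom.ext (funext fun _ => Category.comp_id _)
  assoc f g h := NSeq.Hom.ext (funext fun _ => Category.assoc _ _ _)

/-- The image of a sequence under a functor `F` that commutes with the given endofunctors. -/
def NSeq.map {D' : Type u₂} [Category.{v₂} D'] {S' : D' ⥤ D'} (F : D ⥤ D') (e : S ⋙ F ≅ F ⋙ S')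
    (X : NSeq S r) : NSeq S' r where
  X i := F.obj (X.X i)
  d i h := F.map (X.d i h)
  last := F.map X.last ≫ e.hom.app _

variable [Preadditive D]

/-- Two morphisms `φ, ψ : X ⟶ Y` are homotopic through an `n`-`S`-periodic homotopy. The homotopy
consists of `h i : X (i + 1) ⟶ Y i` for `0 ≤ i ≤ r` and of `s : S (X 0) ⟶ Y (r + 1)`.
For an autoequivalence `S`, the map `s` amounts to a map `X 0 ⟶ S⁻¹ (Y (r + 1))`, and the last
equation is the homotopy equation in degree `0`, translated by `S`. -/
def Homotopic {X Y : NSeq S r} (φ ψ : X ⟶ Y) : Prop :=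
  ∃ (h : ∀ (i : ℕ) (hi : i < r + 1),
        X.X ⟨i + 1, Nat.succ_lt_succ hi⟩ ⟶ Y.X ⟨i, Nat.lt_succ_of_lt hi⟩)
    (s : S.obj (X.X ⟨0, Nat.succ_pos _⟩) ⟶ Y.X ⟨r + 1, Nat.lt_succ_self _⟩),
    (∀ (i : ℕ) (hi : i < r),
      NSeq.Hom.φ φ ⟨i + 1, Nat.lt_succ_of_lt (Nat.succ_lt_succ hi)⟩ -
          NSeq.Hom.φ ψ ⟨i + 1, Nat.lt_succ_of_lt (Nat.succ_lt_succ hi)⟩ =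
        X.d (i + 1) (Nat.succ_lt_succ hi) ≫ h (i + 1) (Nat.succ_lt_succ hi) +
          h i (Nat.lt_succ_of_lt hi) ≫ Y.d i (Nat.lt_succ_of_lt hi)) ∧
    (NSeq.Hom.φ φ ⟨r + 1, Nat.lt_succ_self _⟩ - NSeq.Hom.φ ψ ⟨r + 1, Nat.lt_succ_self _⟩ =
        X.last ≫ s + h r (Nat.lt_succ_self _) ≫ Y.d r (Nat.lt_succ_self _)) ∧
    (S.map (NSeq.Hom.φ φ ⟨0, Nat.succ_pos _⟩ - NSeq.Hom.φ ψ ⟨0, Nat.succ_pos _⟩) =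
        S.map (X.d 0 (Nat.succ_pos _) ≫ h 0 (Nat.succ_pos _)) + s ≫ Y.last)

/-- Homotopy equivalence via `n`-`S`-periodic morphisms and homotopies. -/
def HomotopyEquivalent (X Y : NSeq S r) : Prop :=
  ∃ (φ : X ⟶ Y) (ψ : Y ⟶ X), Homotopic (φ ≫ ψ) (𝟙 X) ∧ Homotopic (ψ ≫ φ) (𝟙 Y)

/-- Exactness of `D(-, X) ⟶ D(-, Y) ⟶ D(-, Z)` at `D(-, Y)`. -/
def HomExact {X Y Z : D} (f : X ⟶ Y) (g : Y ⟶ Z) : Prop :=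
  ∀ W : D, Function.Exact (fun a : W ⟶ X => a ≫ f) (fun b : W ⟶ Y => b ≫ g)

/-- Exactness of an `n`-`S`-sequence. For an autoequivalence `S`, exactness of
`⋯ ⟶ D(-, X₁) ⟶ ⋯ ⟶ D(-, Xₙ) ⟶ D(-, S X₁) ⟶ D(-, S X₂) ⟶ ⋯` has to be required at
`X₂, …, Xₙ, S X₁` only, the other places being translates of these. -/
def NSeq.exact : ObjectProperty (NSeq S r) := fun X =>
  (∀ (i : ℕ) (h : i < r), HomExact (X.d i (Nat.lt_succ_of_lt h)) (X.d (i + 1) (Nat.succ_lt_succ h))) ∧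
    HomExact (X.d r (Nat.lt_succ_self _)) X.last ∧
    HomExact X.last (S.map (X.d 0 (Nat.succ_pos _)))

end Sequences

/-- The category of (acyclic) `n`-`Σ`-complexes with `n`-`Σ`-periodic morphisms: such a complex is
the same as an exact `n`-`Σ`-sequence, continued periodically. -/
abbrev NComplex {D : Type u₁} [Category.{v₁} D] [Preadditive D] (S : D ⥤ D) (r : ℕ) :=
  (NSeq.exact (S := S) (r := r)).FullSubcategory

/-! ### Frobenius categories and stable categories -/

section Frobenius

variable (A : Type u₁) [Category.{v₁} A] [Preadditive A]

/-- `A` is an abelian category which, with all short exact sequences, is a Frobenius category. -/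
structure IsFrobenius : Prop where
  hasFiniteProducts : HasFiniteProducts A
  hasKernels : HasKernels A
  hasCokernels : HasCokernels A
  normalMono : IsNormalMonoCategory A
  normalEpi : IsNormalEpiCategory A
  enoughProjectives : EnoughProjectives A
  enoughInjectives : EnoughInjectives A
  projective_iff_injective : ∀ P : A, Projective P ↔ Injective P

/-- The relation of differing by a morphism that factors through a projective object. -/
def stableRel : HomRel A := fun M N f g =>
  ∃ (P : A) (_ : Projective P) (a : M ⟶ P) (b : P ⟶ N), f - g = a ≫ b

/-- The stable category of `A`. -/
abbrev Stable := CategoryTheory.Quotient (stableRel A)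

/-- The projection from `A` to its stable category. -/
abbrev toStable : A ⥤ Stable A := CategoryTheory.Quotient.functor (stableRel A)

end Frobenius

/-! ### The category `mod C` -/

section Modules

variable (k : Type w) [Field k] (C : Type u) [Category.{v} C] [Preadditive C] [Linear k C]

/-- Finitely presented contravariant functors `F` from `C` to `k`-modules: there is an exact
sequence `C(-, X) ⟶ C(-, Y) ⟶ F ⟶ 0`. -/
def finPres : ObjectProperty (Cᵒᵖ ⥤ ModuleCat.{v} k) := fun F =>
  ∃ (X Y : C) (f : X ⟶ Y) (p : (linearYoneda k C).obj Y ⟶ F),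
    ∀ W : Cᵒᵖ, Function.Exact (((linearYoneda k C).map f).app W).hom (p.app W).hom ∧
      Function.Surjective (p.app W).hom

/-- The category `mod C`. -/
abbrev Mod := (finPres k C).FullSubcategory

variable {k C}

lemma finPres_yoneda (X : C) : finPres k C ((linearYoneda k C).obj X) := by
  refine ⟨X, X, 0, 𝟙 _, fun W => ⟨fun y => ⟨fun hy => ⟨0, ?_⟩, ?_⟩, fun y => ⟨y, rfl⟩⟩⟩
  · rw [map_zero]
    exact hy.symm
  · rintro ⟨x, rfl⟩
    exact comp_zero (f := (show unop W ⟶ X from x))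

variable (k C) in
/-- The Yoneda embedding `C ⥤ mod C`. -/
def yon : C ⥤ Mod k C :=
  (finPres k C).lift (linearYoneda k C) finPres_yoneda

section

variable {B : Type u} [Category.{v} B] (S : B ≌ B)

lemma shift_aux₁ {X W W' : B} (f : W' ⟶ W) (g : W ⟶ S.functor.obj X) :
    S.inverse.map (f ≫ g) ≫ S.unitIso.inv.app X =
      S.inverse.map f ≫ S.inverse.map g ≫ S.unitIso.inv.app X := by
  simp

lemma shift_aux₂ {X Y W : B} (g : W ⟶ S.functor.obj X) (f : X ⟶ Y) :
    S.inverse.map (g ≫ S.functor.map f) ≫ S.unitIso.inv.app Y =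
      (S.inverse.map g ≫ S.unitIso.inv.app X) ≫ f := by
  simp

lemma shift_aux₃ {X Y W : B} (f : X ⟶ Y) (x : S.inverse.obj W ⟶ X) (y : W ⟶ S.functor.obj Y)
    (h : x ≫ f = S.inverse.map y ≫ S.unitIso.inv.app Y) :
    (S.counitIso.inv.app W ≫ S.functor.map x) ≫ S.functor.map f = y := by
  rw [Category.assoc, ← S.functor.map_comp, h]
  simp

lemma shift_aux₄ {Y W : B} (y : S.inverse.obj W ⟶ Y) :
    S.inverse.map (S.counitIso.inv.app W ≫ S.functor.map y) ≫ S.unitIso.inv.app Y = y := by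
  simp

end

variable (S : C ≌ C) [S.functor.Additive] [S.functor.Linear k]

/-- The natural isomorphism `C(-, Σ X) ≅ C(Σ⁻¹ -, X)`, given by `f ↦ Σ⁻¹ f`. -/
def yonedaShift : S.functor ⋙ linearYoneda k C ≅
    linearYoneda k C ⋙ (Functor.whiskeringLeft _ _ (ModuleCat.{v} k)).obj S.inverse.op :=
  NatIso.ofComponents
    (fun X => NatIso.ofComponents
      (fun W => LinearEquiv.toModuleIso
        (show (unop W ⟶ S.functor.obj X) ≃ₗ[k] (S.inverse.obj (unop W) ⟶ X) from
          { toFun := fun f => S.inverse.map f ≫ S.unitIso.inv.app X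
            invFun := fun g => S.counitIso.inv.app (unop W) ≫ S.functor.map g
            map_add' := fun f g => by simp [Functor.map_add]
            map_smul' := fun a f => by simp [Functor.map_smul]
            left_inv := fun f => by simp
            right_inv := fun g => by simp }))
      (fun {W W'} f => by
        ext g
        exact shift_aux₁ S f.unop g))
    (fun {X Y} f => by
      ext W g
      exact shift_aux₂ S g f)

lemma finPres_shift {F : Cᵒᵖ ⥤ ModuleCat.{v} k} (hF : finPres k C F) :
    finPres k C (S.inverse.op ⋙ F) := by
  obtain ⟨X, Y, f, p, hp⟩ := hF
  refine ⟨S.functor.obj X, S.functor.obj Y, S.functor.map f,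
    (yonedaShift S).hom.app Y ≫ Functor.whiskerLeft S.inverse.op p, fun W => ⟨?_, ?_⟩⟩
  · intro y
    have h := (hp (op (S.inverse.obj (unop W)))).1 (((yonedaShift S).hom.app Y).app W y)
    refine h.trans ⟨?_, ?_⟩
    · rintro ⟨x, hx⟩
      refine ⟨((yonedaShift S).inv.app X).app W x, ?_⟩
      exact shift_aux₃ S f x y hx
    · rintro ⟨x, rfl⟩
      refine ⟨((yonedaShift S).hom.app X).app W x, ?_⟩
      exact (shift_aux₂ S x f).symm
  · intro z
    obtain ⟨y, hy⟩ := (hp (op (S.inverse.obj (unop W)))).2 z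
    refine ⟨((yonedaShift S).inv.app Y).app W y, ?_⟩
    exact (congrArg (p.app (op (S.inverse.obj (unop W)))).hom (shift_aux₄ S y)).trans hy

/-- The extension of `Σ` to `mod C`, namely `M ↦ M ∘ Σ⁻¹`. -/
def shift : Mod k C ⥤ Mod k C :=
  (finPres k C).lift
    ((finPres k C).ι ⋙ (Functor.whiskeringLeft _ _ (ModuleCat.{v} k)).obj S.inverse.op)
    (fun M => finPres_shift S M.property)

/-- The Yoneda embedding commutes with `Σ`. -/
def yonShift : S.functor ⋙ yon k C ≅ yon k C ⋙ shift S :=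
  NatIso.ofComponents (fun X => (finPres k C).isoMk ((yonedaShift S).app X)) (fun {X Y} f => by
    apply ObjectProperty.hom_ext
    exact (yonedaShift S).hom.naturality f)

/-! Exactness in `mod C` is exactness at every object of `C`. -/

/-- `f` is injective at every object of `C`. -/
def Inj {M N : Mod k C} (f : M ⟶ N) : Prop := ∀ W, Function.Injective (f.hom.app W).hom

/-- `f` is surjective at every object of `C`. -/
def Surj {M N : Mod k C} (f : M ⟶ N) : Prop := ∀ W, Function.Surjective (f.hom.app W).hom

/-- `L ⟶ M ⟶ N` is exact at `M`. -/
def Exact {L M N : Mod k C} (f : L ⟶ M) (g : M ⟶ N) : Prop :=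
  ∀ W, Function.Exact (f.hom.app W).hom (g.hom.app W).hom

/-! ### Sequences `0 ⟶ M ⟶ Y₁ ⟶ ⋯ ⟶ Yₙ ⟶ N ⟶ 0` and comparison morphisms -/

/-- The data of a sequence `M ⟶ Y 0 ⟶ ⋯ ⟶ Y (r + 1) ⟶ N` in `mod C`. -/
structure LongSeq (r : ℕ) (M N : Mod k C) where
  Y : Fin (r + 2) → Mod k C
  ι : M ⟶ Y ⟨0, Nat.succ_pos _⟩
  d : ∀ (i : ℕ) (h : i < r + 1), Y ⟨i, Nat.lt_succ_of_lt h⟩ ⟶ Y ⟨i + 1, Nat.succ_lt_succ h⟩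
  π : Y ⟨r + 1, Nat.lt_succ_self _⟩ ⟶ N

/-- `0 ⟶ M ⟶ Y 0 ⟶ ⋯ ⟶ Y (r + 1) ⟶ N ⟶ 0` is exact. -/
structure LongSeq.IsExact {r : ℕ} {M N : Mod k C} (E : LongSeq r M N) : Prop where
  inj : Inj E.ι
  exact_ι : Exact E.ι (E.d 0 (Nat.succ_pos _))
  exact_d : ∀ (i : ℕ) (h : i < r),
    Exact (E.d i (Nat.lt_succ_of_lt h)) (E.d (i + 1) (Nat.succ_lt_succ h))
  exact_π : Exact (E.d r (Nat.lt_succ_self _)) E.π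
  surj : Surj E.π

/-- `α : N ⟶ N'` is induced by a morphism of sequences `E ⟶ E'` that is the identity on `M`. If
`E` is exact and `E'` is exact with injective middle terms, then such an `α` exists by the comparison
theorem, and all of them have the same class in the stable category. -/
def IsComparison {r : ℕ} {M N N' : Mod k C} (E : LongSeq r M N) (E' : LongSeq r M N')
    (α : N ⟶ N') : Prop :=
  ∃ φ : ∀ i, E.Y i ⟶ E'.Y i,
    E.ι ≫ φ ⟨0, Nat.succ_pos _⟩ = E'.ι ∧
    (∀ (i : ℕ) (h : i < r + 1),
      E.d i h ≫ φ ⟨i + 1, Nat.succ_lt_succ h⟩ = φ ⟨i, Nat.lt_succ_of_lt h⟩ ≫ E'.d i h) ∧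
    E.π ≫ α = φ ⟨r + 1, Nat.lt_succ_self _⟩ ≫ E'.π

variable (k C) in
/-- A choice, for every `M` in `mod C`, of a short exact sequence `0 ⟶ M ⟶ I M ⟶ Ω M ⟶ 0` with
`I M` projective(-injective); `Ω M` is written `Ω⁻¹ M` in the literature. -/
structure Cosyzygies where
  I : Mod k C → Mod k C
  Ω : Mod k C → Mod k C
  i : ∀ M, M ⟶ I M
  p : ∀ M, I M ⟶ Ω M
  projective : ∀ M, Projective (I M)
  inj : ∀ M, Inj (i M)
  exact : ∀ M, Exact (i M) (p M)
  surj : ∀ M, Surj (p M)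

namespace Cosyzygies

variable (c : Cosyzygies k C)

/-- The iterated cosyzygies `Ω⁻ʲ M`. -/
def iter (M : Mod k C) : ℕ → Mod k C
  | 0 => M
  | j + 1 => c.Ω (iter M j)

/-- The standard injective resolution
`M ⟶ I_M ⟶ I_{Ω⁻¹ M} ⟶ ⋯ ⟶ I_{Ω⁻⁽ⁿ⁻¹⁾ M} ⟶ Ω⁻ⁿ M`, with `n = r + 2`. -/
def resolution (r : ℕ) (M : Mod k C) : LongSeq r M (c.iter M (r + 2)) where
  Y j := c.I (c.iter M j)
  ι := c.i M
  d j _ := c.p (c.iter M j) ≫ c.i (c.iter M (j + 1))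
  π := c.p (c.iter M (r + 1))

end Cosyzygies

/-- An exact sequence `0 ⟶ Id ⟶ X 0 ⟶ ⋯ ⟶ X (r + 1) ⟶ Σ ⟶ 0` of exact endofunctors of `mod C`
where the `X i` take projective values. -/
structure FunctorSeq (r : ℕ) where
  X : Fin (r + 2) → (Mod k C ⥤ Mod k C)
  ι : 𝟭 (Mod k C) ⟶ X ⟨0, Nat.succ_pos _⟩
  d : ∀ (i : ℕ) (h : i < r + 1), X ⟨i, Nat.lt_succ_of_lt h⟩ ⟶ X ⟨i + 1, Nat.succ_lt_succ h⟩
  π : X ⟨r + 1, Nat.lt_succ_self _⟩ ⟶ shift S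
  preservesLimits : ∀ i, PreservesFiniteLimits (X i)
  preservesColimits : ∀ i, PreservesFiniteColimits (X i)
  projective : ∀ i M, Projective ((X i).obj M)
  exact : ∀ M, LongSeq.IsExact (r := r) (M := M) (N := (shift S).obj M)
    { Y := fun i => (X i).obj M
      ι := ι.app M
      d := fun i h => (d i h).app M
      π := π.app M }

variable {S}
variable {r : ℕ}

namespace FunctorSeq

variable (T : FunctorSeq (k := k) S r)

/-- The value `0 ⟶ M ⟶ X 0 M ⟶ ⋯ ⟶ X (r + 1) M ⟶ Σ M ⟶ 0` of the sequence at `M`. -/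
def eval (M : Mod k C) : LongSeq r M ((shift S).obj M) where
  Y i := (T.X i).obj M
  ι := T.ι.app M
  d i h := (T.d i h).app M
  π := T.π.app M

/-- The standard `n`-angle `T_M`, i.e. `X 0 M ⟶ ⋯ ⟶ X (r + 1) M ⟶ Σ (X 0 M)`, where the last arrow
is the composite `X (r + 1) M ⟶ Σ M ⟶ Σ (X 0 M)`. Its terms are projective objects of `mod C`. -/
def std (M : Mod k C) : NSeq (shift (k := k) S) r where
  X i := (T.X i).obj M
  d i h := (T.d i h).app M
  last := T.π.app M ≫ (shift S).map (T.ι.app M)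

end FunctorSeq

variable (k) in
/-- An `n`-`Σ`-sequence in `C`, viewed in `mod C` through the Yoneda embedding. -/
def toMod (X : NSeq S.functor r) : NSeq (shift (k := k) S) r :=
  X.map (yon k C) (yonShift S)

/-- The sequence `M ⟶ X 0 ⟶ ⋯ ⟶ X (r + 1) ⟶ Σ M` in `mod C` obtained from an
`n`-`Σ`-sequence `X` in `C`, a morphism `l : M ⟶ X 0` and a morphism `π : X (r + 1) ⟶ Σ M`. -/
def kerSeq (X : NSeq S.functor r) {M : Mod k C} (l : M ⟶ (toMod k X).X ⟨0, Nat.succ_pos _⟩)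
    (π : (toMod k X).X ⟨r + 1, Nat.lt_succ_self _⟩ ⟶ (shift S).obj M) :
    LongSeq r M ((shift S).obj M) where
  Y := (toMod k X).X
  ι := l
  d := (toMod k X).d
  π := π

/-- The `n`-`Σ`-complexes in the class `Φ`: if `l : M ⟶ X 0` is the kernel of the first arrow of `X`
and the last arrow of `X` is factored as `X (r + 1) ⟶ Σ M ⟶ Σ (X 0)`, then the comparison
`α : Σ M ⟶ Ω⁻ⁿ M` from the functor sequence and the comparison `β : Σ M ⟶ Ω⁻ⁿ M` from `X` are
equal in the stable category. -/
def Phi (c : Cosyzygies k C) (T : FunctorSeq (k := k) S r) :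
    ObjectProperty (NComplex S.functor r) := fun X =>
  ∃ (M : Mod k C) (l : M ⟶ (toMod k X.obj).X ⟨0, Nat.succ_pos _⟩)
    (π : (toMod k X.obj).X ⟨r + 1, Nat.lt_succ_self _⟩ ⟶ (shift S).obj M),
    Inj l ∧ Exact l ((toMod k X.obj).d 0 (Nat.succ_pos _)) ∧
    π ≫ (shift S).map l = (toMod k X.obj).last ∧
    ∃ α β : (shift S).obj M ⟶ c.iter M (r + 2),
      IsComparison (T.eval M) (c.resolution r M) α ∧
      IsComparison (kerSeq X.obj l π) (c.resolution r M) β ∧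
      (toStable (Mod k C)).map β = (toStable (Mod k C)).map α

/-- The `n`-`Σ`-complexes that are homotopy equivalent, via `n`-`Σ`-periodic homotopy, to a standard
`n`-angle. -/
def HtpyStandard (T : FunctorSeq (k := k) S r) : ObjectProperty (NComplex S.functor r) := fun X =>
  ∃ M : Mod k C, HomotopyEquivalent (toMod k X.obj) (T.std M)

end Modules

end NAngle

namespace NAngle

section Modules

variable {k : Type w} [Field k] {C : Type u} [Category.{v} C] [Preadditive C] [Linear k C]

/-! ### Elements of finitely presented modules -/

lemma comp_app_apply {L M N : Mod k C} (f : L ⟶ M) (g : M ⟶ N) (W : Cᵒᵖ) (x : L.obj.obj W) :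
    ((f ≫ g).hom.app W).hom x = (g.hom.app W).hom ((f.hom.app W).hom x) := rfl

lemma zero_app_apply {M N : Mod k C} (W : Cᵒᵖ) (x : M.obj.obj W) :
    ((0 : M ⟶ N).hom.app W).hom x = 0 := rfl

lemma Mod.ext_apply {M N : Mod k C} {f g : M ⟶ N}
    (h : ∀ W x, (f.hom.app W).hom x = (g.hom.app W).hom x) : f = g := by
  apply ObjectProperty.hom_ext
  ext W x
  exact h W x

/-- The value of a morphism out of a representable module at the identity. -/
def elemOf {X : C} {M : Mod k C} (f : (yon k C).obj X ⟶ M) : M.obj.obj (op X) :=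
  (f.hom.app (op X)).hom (𝟙 X)

lemma elemOf_surjective {X : C} {M : Mod k C} (x : M.obj.obj (op X)) :
    ∃ f : (yon k C).obj X ⟶ M, elemOf f = x := by
  obtain ⟨_, Y, _, p, hp⟩ := M.property
  obtain ⟨y, hy⟩ := (hp (op X)).2 x
  refine ⟨ObjectProperty.homMk ((linearYoneda k C).map (show X ⟶ Y from y) ≫ p), ?_⟩
  refine Eq.trans ?_ hy
  exact congrArg (p.app (op X)).hom (Category.id_comp (X := X) (show X ⟶ Y from y))

lemma elemOf_injective {X : C} {M : Mod k C} {f g : (yon k C).obj X ⟶ M}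
    (h : elemOf f = elemOf g) : f = g := by
  have key : ∀ (e : (yon k C).obj X ⟶ M) (W : Cᵒᵖ) (a : unop W ⟶ X),
      (e.hom.app W).hom a = (M.obj.map a.op).hom (elemOf e) := by
    intro e W a
    have := ConcreteCategory.congr_hom (e.hom.naturality a.op) (𝟙 X)
    refine Eq.trans ?_ this
    exact congrArg (e.hom.app W).hom (Category.comp_id a).symm
  apply Mod.ext_apply
  intro W a
  exact (key f W a).trans ((congrArg _ h).trans (key g W a).symm)

lemma exists_surj_yon (M : Mod k C) : ∃ (Y : C) (p : (yon k C).obj Y ⟶ M), Surj p := by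
  obtain ⟨_, Y, _, p, hp⟩ := M.property
  exact ⟨Y, ObjectProperty.homMk p, fun W => (hp W).2⟩

/-! ### Exactness at every object and abstract exactness -/

lemma Inj.mono {M N : Mod k C} {f : M ⟶ N} (hf : Inj f) : Mono f := by
  refine ⟨fun a b h => Mod.ext_apply fun W x => hf W ?_⟩
  rw [← comp_app_apply, h, comp_app_apply]

lemma Surj.epi {M N : Mod k C} {f : M ⟶ N} (hf : Surj f) : Epi f := by
  refine ⟨fun a b h => Mod.ext_apply fun W y => ?_⟩
  obtain ⟨x, rfl⟩ := hf W y
  rw [← comp_app_apply, h, comp_app_apply]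

lemma inj_of_mono {M N : Mod k C} (f : M ⟶ N) [Mono f] : Inj f := by
  intro W x y h
  obtain ⟨a, rfl⟩ := elemOf_surjective (X := unop W) x
  obtain ⟨b, rfl⟩ := elemOf_surjective (X := unop W) y
  exact congrArg elemOf ((cancel_mono f).1 (elemOf_injective (f := a ≫ f) (g := b ≫ f) h))

lemma Exact.comp_eq_zero {L M N : Mod k C} {f : L ⟶ M} {g : M ⟶ N} (h : Exact f g) :
    f ≫ g = 0 :=
  Mod.ext_apply fun W x => (h W _).2 ⟨x, rfl⟩

lemma Exact.exists_lift {L M N : Mod k C} {f : L ⟶ M} {g : M ⟶ N} (h : Exact f g) {X : C}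
    (a : (yon k C).obj X ⟶ M) (ha : a ≫ g = 0) : ∃ b : (yon k C).obj X ⟶ L, b ≫ f = a := by
  obtain ⟨x, hx⟩ := (h (op X) (elemOf a)).1 (congrArg elemOf ha)
  obtain ⟨b, rfl⟩ := elemOf_surjective (M := L) x
  exact ⟨b, elemOf_injective hx⟩

lemma exact_of_lift {L M N : Mod k C} {f : L ⟶ M} {g : M ⟶ N} (w : f ≫ g = 0)
    (h : ∀ {X : C} (a : (yon k C).obj X ⟶ M), a ≫ g = 0 →
      ∃ b : (yon k C).obj X ⟶ L, b ≫ f = a) : Exact f g := by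
  intro W y
  constructor
  · intro hy
    obtain ⟨a, rfl⟩ := elemOf_surjective (X := unop W) y
    obtain ⟨b, rfl⟩ := h a (elemOf_injective hy)
    exact ⟨elemOf b, rfl⟩
  · rintro ⟨x, rfl⟩
    change ((f ≫ g).hom.app W).hom x = 0
    rw [w, zero_app_apply]

lemma Inj.exact_comp {L M N N' : Mod k C} {f : L ⟶ M} {g : M ⟶ N} {j : N ⟶ N'}
    (hj : Inj j) (h : Exact f g) : Exact f (g ≫ j) := by
  intro W y
  refine Iff.trans ⟨fun hy => hj W ?_, fun hy => ?_⟩ (h W y)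
  · rw [map_zero]
    exact hy
  · rw [comp_app_apply, hy, map_zero]

lemma Surj.comp_exact {L' L M N : Mod k C} {q : L' ⟶ L} {f : L ⟶ M} {g : M ⟶ N}
    (hq : Surj q) (h : Exact f g) : Exact (q ≫ f) g := by
  intro W y
  refine (h W y).trans ⟨?_, ?_⟩
  · rintro ⟨x, rfl⟩
    obtain ⟨x', rfl⟩ := hq W x
    exact ⟨x', rfl⟩
  · rintro ⟨x', rfl⟩
    exact ⟨_, rfl⟩

lemma Exact.of_comp_inj {L M N N' : Mod k C} {f : L ⟶ M} {g : M ⟶ N} {j : N ⟶ N'}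
    (hj : Inj j) (h : Exact f (g ≫ j)) : Exact f g := by
  intro W y
  refine Iff.trans ⟨fun hy => ?_, fun hy => hj W ?_⟩ (h W y)
  · rw [comp_app_apply, hy, map_zero]
  · rw [map_zero]
    exact hy

/-- If `f` has the same image as the injective map `j`, it factors through `j` by a surjection. -/
lemma surj_of_exact_of_exact {L L' M N : Mod k C} {q : L' ⟶ L} {j : L ⟶ M} {g : M ⟶ N}
    (hj : Inj j) (w : j ≫ g = 0) (h : Exact (q ≫ j) g) : Surj q := by
  intro W x
  obtain ⟨x', hx'⟩ := (h W ((j.hom.app W).hom x)).1 (by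
    rw [← comp_app_apply, w, zero_app_apply])
  exact ⟨x', hj W hx'⟩

/-- The cokernel of `f`, computed at every object, is finitely presented. -/
lemma finPres_cokernel [HasFiniteBiproducts C] {M N : Mod k C} (f : M ⟶ N)
    {Q : Cᵒᵖ ⥤ ModuleCat.{v} k} (q : N.obj ⟶ Q)
    (hq : ∀ W, Function.Exact (f.hom.app W).hom (q.app W).hom ∧
      Function.Surjective (q.app W).hom) : finPres k C Q := by
  have : HasBinaryBiproducts C := hasBinaryBiproducts_of_finite_biproducts C
  obtain ⟨X, Y, g, p, hp⟩ := N.property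
  obtain ⟨Z, m, hm⟩ := exists_surj_yon M
  obtain ⟨z, hz⟩ : ∃ z : Z ⟶ Y, (p.app (op Z)).hom z = elemOf (m ≫ f) :=
    (hp (op Z)).2 (elemOf (m ≫ f))
  have hz' : m ≫ f = (yon k C).map z ≫ ObjectProperty.homMk p := by
    apply elemOf_injective
    refine hz.symm.trans ?_
    exact congrArg (p.app (op Z)).hom (Category.id_comp (X := Z) z).symm
  have hz₂ : ∀ (W : Cᵒᵖ) (a : unop W ⟶ Z), (f.hom.app W).hom ((m.hom.app W).hom a) =
      (p.app W).hom (show unop W ⟶ Y from a ≫ z) := fun W a =>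
    congrArg (fun e : (yon k C).obj Z ⟶ N => (e.hom.app W).hom a) hz'
  refine ⟨X ⊞ Z, Y, biprod.desc g z, p ≫ q, fun W => ⟨fun y => ⟨fun hy => ?_, ?_⟩, ?_⟩⟩
  · obtain ⟨x, hx⟩ := ((hq W).1 _).1 hy
    obtain ⟨a, rfl⟩ := hm W x
    have h0 : (p.app W).hom ((show unop W ⟶ Y from y) - (show unop W ⟶ Z from a) ≫ z) = 0 := by
      refine (map_sub (p.app W).hom _ _).trans ?_
      rw [sub_eq_zero]
      exact hx.symm.trans (hz₂ W a)
    obtain ⟨b, hb⟩ := ((hp W).1 _).1 h0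
    refine ⟨biprod.lift (show unop W ⟶ X from b) (show unop W ⟶ Z from a), ?_⟩
    refine (biprod.lift_desc (f := (show unop W ⟶ X from b))
      (g := (show unop W ⟶ Z from a)) (h := g) (i := z)).trans ?_
    exact eq_add_of_sub_eq hb.symm ▸ rfl
  · rintro ⟨b, rfl⟩
    have e : ∀ {V : C} (b : V ⟶ X ⊞ Z),
        b ≫ biprod.desc g z = (b ≫ biprod.fst) ≫ g + (b ≫ biprod.snd) ≫ z := by
      intro V b
      rw [biprod.desc_eq]
      simp
    refine (congrArg (fun y => (q.app W).hom ((p.app W).hom y))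
      (e (show unop W ⟶ X ⊞ Z from b))).trans ?_
    refine (congrArg (q.app W).hom (map_add (p.app W).hom _ _)).trans ?_
    refine (map_add (q.app W).hom _ _).trans ?_
    rw [← hz₂]
    have h1 : (p.app W).hom (show unop W ⟶ Y from
        ((show unop W ⟶ X ⊞ Z from b) ≫ biprod.fst) ≫ g) = 0 := ((hp W).1 _).2 ⟨_, rfl⟩
    have h2 : ∀ x, (q.app W).hom ((f.hom.app W).hom x) = 0 := fun x => ((hq W).1 _).2 ⟨x, rfl⟩
    rw [h2, h1, map_zero, add_zero]
  · exact (hq W).2.comp (hp W).2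

lemma surj_of_epi [HasFiniteBiproducts C] {M N : Mod k C} (f : M ⟶ N) [Epi f] : Surj f := by
  have hq : ∀ W, Function.Exact (f.hom.app W).hom ((cokernel.π f.hom).app W).hom ∧
      Function.Surjective ((cokernel.π f.hom).app W).hom := by
    intro W
    have hE := (ShortComplex.exact_cokernel f.hom).map ((evaluation _ _).obj W)
    have hS : Epi ((cokernel.π f.hom).app W) :=
      inferInstanceAs (Epi (((evaluation _ _).obj W).map (cokernel.π f.hom)))
    refine ⟨?_, (ModuleCat.epi_iff_surjective _).1 hS⟩
    exact (ShortComplex.ShortExact.moduleCat_exact_iff_function_exact _).1 hE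
  let Q : Mod k C := ⟨cokernel f.hom, finPres_cokernel f _ hq⟩
  have h0 : (ObjectProperty.homMk (cokernel.π f.hom) : N ⟶ Q) = 0 := by
    rw [← cancel_epi f, comp_zero]
    exact ObjectProperty.hom_ext _ (cokernel.condition f.hom)
  intro W y
  refine ((hq W).1 y).1 ?_
  exact congrArg (fun e : N ⟶ Q => (e.hom.app W).hom y) h0

instance projective_yon [HasFiniteBiproducts C] (X : C) : Projective ((yon k C).obj X) where
  factors {E N} a e he := by
    obtain ⟨x, hx⟩ := surj_of_epi e (op X) (elemOf a)
    obtain ⟨b, rfl⟩ := elemOf_surjective (M := E) x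
    exact ⟨b, elemOf_injective hx⟩

section Abelian

/-- The abelian structure of a Frobenius category. -/
abbrev IsFrobenius.abelian {A : Type u₁} [Category.{v₁} A] [Preadditive A] (h : IsFrobenius A) :
    Abelian A :=
  have := h.hasFiniteProducts
  have := h.hasKernels
  have := h.hasCokernels
  have := h.normalMono
  have := h.normalEpi
  { }

lemma Exact.shortComplex_exact (hFrob : IsFrobenius (Mod k C))
    {L M N : Mod k C} {f : L ⟶ M} {g : M ⟶ N} (h : Exact f g) :
    (ShortComplex.mk f g h.comp_eq_zero).Exact := by
  let _ := hFrob.abelian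
  rw [ShortComplex.exact_iff_exact_up_to_refinements]
  intro A x hx
  obtain ⟨Y, p, hp⟩ := exists_surj_yon A
  obtain ⟨b, hb⟩ := h.exists_lift (p ≫ x) (by rw [Category.assoc, hx, comp_zero])
  exact ⟨_, p, hp.epi, b, hb.symm⟩

lemma Exact.exists_extension (hFrob : IsFrobenius (Mod k C))
    {L M N I : Mod k C} {f : L ⟶ M} {g : M ⟶ N} (h : Exact f g)
    (hI : Projective I) (u : M ⟶ I) (hu : f ≫ u = 0) : ∃ v : N ⟶ I, g ≫ v = u := by
  let _ := hFrob.abelian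
  have : Injective I := (hFrob.projective_iff_injective I).1 hI
  exact ⟨(h.shortComplex_exact hFrob).descToInjective u hu,
    (h.shortComplex_exact hFrob).comp_descToInjective u hu⟩

lemma Inj.exists_extension (hFrob : IsFrobenius (Mod k C))
    {M N I : Mod k C} {f : M ⟶ N} (h : Inj f)
    (hI : Projective I) (u : M ⟶ I) : ∃ v : N ⟶ I, f ≫ v = u := by
  have : Injective I := (hFrob.projective_iff_injective I).1 hI
  have := h.mono
  exact ⟨Injective.factorThru u f, Injective.comp_factorThru u f⟩

lemma Exact.exists_desc (hFrob : IsFrobenius (Mod k C))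
    {L M N I : Mod k C} {f : L ⟶ M} {g : M ⟶ N} (h : Exact f g)
    (hg : Surj g) (u : M ⟶ I) (hu : f ≫ u = 0) : ∃ v : N ⟶ I, g ≫ v = u := by
  let _ := hFrob.abelian
  have : Epi g := hg.epi
  exact ⟨(h.shortComplex_exact hFrob).desc u hu, (h.shortComplex_exact hFrob).g_desc u hu⟩

lemma Exact.exists_lift_of_inj (hFrob : IsFrobenius (Mod k C))
    {L M N I : Mod k C} {f : L ⟶ M} {g : M ⟶ N} (h : Exact f g)
    (hf : Inj f) (u : I ⟶ M) (hu : u ≫ g = 0) : ∃ v : I ⟶ L, v ≫ f = u := by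
  let _ := hFrob.abelian
  have : Mono f := hf.mono
  exact ⟨(h.shortComplex_exact hFrob).lift u hu, (h.shortComplex_exact hFrob).lift_f u hu⟩

lemma Surj.exists_lift {M N P : Mod k C} {g : M ⟶ N} (hg : Surj g) (hP : Projective P)
    (u : P ⟶ N) : ∃ v : P ⟶ M, v ≫ g = u :=
  have := hg.epi
  ⟨Projective.factorThru u g, Projective.factorThru_comp u g⟩

lemma exists_inj_exact (hFrob : IsFrobenius (Mod k C))
    {M N : Mod k C} (g : M ⟶ N) :
    ∃ (K : Mod k C) (l : K ⟶ M), Inj l ∧ Exact l g := by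
  have := hFrob.hasKernels
  refine ⟨kernel g, kernel.ι g, inj_of_mono _, exact_of_lift (kernel.condition g) ?_⟩
  intro X a ha
  exact ⟨kernel.lift g a ha, kernel.lift_ι g a ha⟩

end Abelian

/-! ### The shift -/

section Shift

variable (S : C ≌ C) [S.functor.Additive] [S.functor.Linear k]

instance : (shift (k := k) S).Additive where
  map_add := rfl

lemma isEquivalence_whiskeringLeft_inverse_op {B : Type u} [Category.{v} B] (S : B ≌ B) :
    ((Functor.whiskeringLeft _ _ (ModuleCat.{v} k)).obj S.inverse.op).IsEquivalence :=
  inferInstanceAs (S.op.congrLeft (E := ModuleCat.{v} k)).functor.IsEquivalence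

instance : (shift (k := k) S).Full :=
  have := isEquivalence_whiskeringLeft_inverse_op (k := k) S
  inferInstanceAs (ObjectProperty.lift _ _ _).Full

instance : (shift (k := k) S).Faithful :=
  have := isEquivalence_whiskeringLeft_inverse_op (k := k) S
  inferInstanceAs (ObjectProperty.lift _ _ _).Faithful

variable {S}

lemma Inj.shift_map {M N : Mod k C} {f : M ⟶ N} (h : Inj f) : Inj ((shift S).map f) :=
  fun W => h (op (S.inverse.obj (unop W)))

lemma Exact.shift_map {L M N : Mod k C} {f : L ⟶ M} {g : M ⟶ N} (h : Exact f g) :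
    Exact ((shift S).map f) ((shift S).map g) :=
  fun W => h (op (S.inverse.obj (unop W)))

/-- Every representable module is a shift of a representable one. -/
lemma exists_yon_iso_shift (X : C) :
    ∃ Y : C, Nonempty ((yon k C).obj X ≅ (shift S).obj ((yon k C).obj Y)) :=
  ⟨S.inverse.obj X, ⟨(yon k C).mapIso (S.counitIso.symm.app X) ≪≫ (yonShift S).app _⟩⟩

/-- A morphism factors through a projective module if its shift factors through a representable
one. -/
lemma exists_factorization_of_shift [HasFiniteBiproducts C] {M N : Mod k C} (f : M ⟶ N) (X : C)
    (a : (shift S).obj M ⟶ (yon k C).obj X) (b : (yon k C).obj X ⟶ (shift S).obj N)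
    (h : (shift S).map f = a ≫ b) :
    ∃ (P : Mod k C) (_ : Projective P) (a' : M ⟶ P) (b' : P ⟶ N), f = a' ≫ b' := by
  obtain ⟨Y, ⟨e⟩⟩ := exists_yon_iso_shift (k := k) (S := S) X
  refine ⟨(yon k C).obj Y, inferInstance, (shift S).preimage (a ≫ e.hom),
    (shift S).preimage (e.inv ≫ b), (shift S).map_injective ?_⟩
  simp [h]

end Shift

end Modules

/-- Dependent choice along `0, …, n - 1`. -/
lemma exists_chain {n : ℕ} {F : ∀ i, i < n → Type*} (P : ∀ i h, F i h → Prop)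
    (R : ∀ i (h : i + 1 < n), F i (Nat.lt_of_succ_lt h) → F (i + 1) h → Prop)
    (h0 : 0 < n) (x0 : F 0 h0) (hx0 : P 0 h0 x0)
    (step : ∀ i (h : i + 1 < n) x, P i (Nat.lt_of_succ_lt h) x →
      ∃ y, P (i + 1) h y ∧ R i h x y) :
    ∃ f : ∀ i h, F i h, f 0 h0 = x0 ∧ (∀ i h, P i h (f i h)) ∧
      ∀ i h, R i h (f i (Nat.lt_of_succ_lt h)) (f (i + 1) h) := by
  choose g hg using step
  let s : ∀ i (h : i < n), {x : F i h // P i h x} := fun i =>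
    Nat.rec (motive := fun i => ∀ h : i < n, {x : F i h // P i h x}) (fun _ => ⟨x0, hx0⟩)
      (fun i ih h => ⟨g i h (ih _).1 (ih _).2, (hg i h (ih _).1 (ih _).2).1⟩) i
  exact ⟨fun i h => (s i h).1, rfl, fun i h => (s i h).2,
    fun i h => (hg i h (s i _).1 (s i _).2).2⟩

section Modules

variable {k : Type w} [Field k] {C : Type u} [Category.{v} C] [Preadditive C] [Linear k C]

namespace LongSeq

variable {r : ℕ} {M M' M'' N N' N'' : Mod k C}

/-- Morphisms of sequences with prescribed components `u` and `α` at the ends. -/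
structure Map (E : LongSeq r M N) (E' : LongSeq r M' N') (u : M ⟶ M') (α : N ⟶ N') where
  φ : ∀ i, E.Y i ⟶ E'.Y i
  comm_ι : E.ι ≫ φ ⟨0, Nat.succ_pos _⟩ = u ≫ E'.ι
  comm_d : ∀ (i : ℕ) (h : i < r + 1),
    E.d i h ≫ φ ⟨i + 1, Nat.succ_lt_succ h⟩ = φ ⟨i, Nat.lt_succ_of_lt h⟩ ≫ E'.d i h
  comm_π : E.π ≫ α = φ ⟨r + 1, Nat.lt_succ_self _⟩ ≫ E'.π

lemma isComparison_iff {E : LongSeq r M N} {E' : LongSeq r M N'} {α : N ⟶ N'} :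
    IsComparison E E' α ↔ Nonempty (Map E E' (𝟙 M) α) := by
  constructor
  · rintro ⟨φ, h1, h2, h3⟩
    exact ⟨⟨φ, by rw [h1, Category.id_comp], h2, h3⟩⟩
  · rintro ⟨φ, h1, h2, h3⟩
    exact ⟨φ, by rw [h1, Category.id_comp], h2, h3⟩

namespace Map

variable {E : LongSeq r M N} {E' : LongSeq r M' N'} {E'' : LongSeq r M'' N''}
  {u : M ⟶ M'} {α : N ⟶ N'}

/-- The identity of a sequence. -/
def id (E : LongSeq r M N) : Map E E (𝟙 M) (𝟙 N) where
  φ _ := 𝟙 _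
  comm_ι := by rw [Category.comp_id, Category.id_comp]
  comm_d _ _ := by rw [Category.comp_id, Category.id_comp]
  comm_π := by rw [Category.comp_id, Category.id_comp]

/-- The composite of two morphisms of sequences. -/
def comp {u' : M' ⟶ M''} {α' : N' ⟶ N''} (f : Map E E' u α) (g : Map E' E'' u' α') :
    Map E E'' (u ≫ u') (α ≫ α') where
  φ i := f.φ i ≫ g.φ i
  comm_ι := by rw [← Category.assoc, f.comm_ι, Category.assoc, g.comm_ι, Category.assoc]
  comm_d i h := by rw [← Category.assoc, f.comm_d, Category.assoc, g.comm_d, Category.assoc]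
  comm_π := by rw [← Category.assoc, f.comm_π, Category.assoc, g.comm_π, Category.assoc]

/-- The difference of two morphisms of sequences. -/
def sub {u' : M ⟶ M'} {α' : N ⟶ N'} (f : Map E E' u α) (g : Map E E' u' α') :
    Map E E' (u - u') (α - α') where
  φ i := f.φ i - g.φ i
  comm_ι := by rw [Preadditive.comp_sub, f.comm_ι, g.comm_ι, Preadditive.sub_comp]
  comm_d i h := by rw [Preadditive.comp_sub, f.comm_d, g.comm_d, Preadditive.sub_comp]
  comm_π := by rw [Preadditive.comp_sub, f.comm_π, g.comm_π, Preadditive.sub_comp]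

end Map

lemma exists_map (hFrob : IsFrobenius (Mod k C)) {E : LongSeq r M N} (hE : E.IsExact)
    {E' : LongSeq r M' N'} (hE' : E'.IsExact) (hP : ∀ i, Projective (E'.Y i)) (u : M ⟶ M') :
    ∃ α, Nonempty (Map E E' u α) := by
  obtain ⟨x0, hx0⟩ := hE.inj.exists_extension hFrob (hP _) (u ≫ E'.ι)
  have hstep : ∀ (i : ℕ) (h : i + 1 < r + 2)
      (x : E.Y ⟨i, Nat.lt_of_succ_lt h⟩ ⟶ E'.Y ⟨i, Nat.lt_of_succ_lt h⟩),
      (∀ h' : i < r + 1, ∃ y, E.d i h' ≫ y = x ≫ E'.d i h') →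
      ∃ y : E.Y ⟨i + 1, h⟩ ⟶ E'.Y ⟨i + 1, h⟩,
        (∀ h' : i + 1 < r + 1, ∃ z, E.d (i + 1) h' ≫ z = y ≫ E'.d (i + 1) h') ∧
        E.d i (Nat.lt_of_succ_lt_succ h) ≫ y = x ≫ E'.d i (Nat.lt_of_succ_lt_succ h) := by
    intro i h x hx
    obtain ⟨y, hy⟩ := hx (Nat.lt_of_succ_lt_succ h)
    refine ⟨y, fun h' => ?_, hy⟩
    refine (hE.exact_d i (Nat.lt_of_succ_lt_succ h')).exists_extension hFrob (hP _) _ ?_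
    rw [← Category.assoc, hy, Category.assoc,
      (hE'.exact_d i (Nat.lt_of_succ_lt_succ h')).comp_eq_zero, comp_zero]
  obtain ⟨f, hf0, -, hf⟩ := exists_chain
    (F := fun i h => E.Y ⟨i, h⟩ ⟶ E'.Y ⟨i, h⟩)
    (fun i h x => ∀ h' : i < r + 1, ∃ y, E.d i h' ≫ y = x ≫ E'.d i h')
    (fun i h x y => E.d i (Nat.lt_of_succ_lt_succ h) ≫ y =
      x ≫ E'.d i (Nat.lt_of_succ_lt_succ h))
    (Nat.succ_pos _) x0
    (fun h' => hE.exact_ι.exists_extension hFrob (hP _) _ (by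
      rw [← Category.assoc, hx0, Category.assoc, hE'.exact_ι.comp_eq_zero, comp_zero]))
    hstep
  obtain ⟨α, hα⟩ := hE.exact_π.exists_desc hFrob hE.surj (f (r + 1) (Nat.lt_succ_self _) ≫ E'.π)
    (by rw [← Category.assoc, hf r (Nat.lt_succ_self _), Category.assoc,
      hE'.exact_π.comp_eq_zero, comp_zero])
  exact ⟨α, ⟨⟨fun i => f i.1 i.2, by rw [hf0]; exact hx0,
    fun i h => hf i (Nat.succ_lt_succ h), hα⟩⟩⟩

/-- A morphism of sequences into projective-injective terms whose left component `u` factors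
through the first map is null-homotopic, up to a morphism `g` out of the last term. -/
lemma Map.exists_homotopy (hFrob : IsFrobenius (Mod k C)) {E : LongSeq r M N} (hE : E.IsExact)
    {E' : LongSeq r M' N'} (hE' : E'.IsExact) (hP : ∀ i, Projective (E'.Y i))
    {u : M ⟶ M'} {α : N ⟶ N'} (f : Map E E' u α)
    (h₀ : E.Y ⟨0, Nat.succ_pos _⟩ ⟶ M') (hu : E.ι ≫ h₀ = u) :
    ∃ (h : ∀ (i : ℕ) (hi : i < r + 1),
          E.Y ⟨i + 1, Nat.succ_lt_succ hi⟩ ⟶ E'.Y ⟨i, Nat.lt_succ_of_lt hi⟩)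
      (g : N ⟶ E'.Y ⟨r + 1, Nat.lt_succ_self _⟩),
      f.φ ⟨0, Nat.succ_pos _⟩ = h₀ ≫ E'.ι + E.d 0 (Nat.succ_pos _) ≫ h 0 (Nat.succ_pos _) ∧
      (∀ (i : ℕ) (hi : i < r), f.φ ⟨i + 1, Nat.lt_succ_of_lt (Nat.succ_lt_succ hi)⟩ =
        E.d (i + 1) (Nat.succ_lt_succ hi) ≫ h (i + 1) (Nat.succ_lt_succ hi) +
          h i (Nat.lt_succ_of_lt hi) ≫ E'.d i (Nat.lt_succ_of_lt hi)) ∧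
      f.φ ⟨r + 1, Nat.lt_succ_self _⟩ =
        E.π ≫ g + h r (Nat.lt_succ_self _) ≫ E'.d r (Nat.lt_succ_self _) ∧
      α = g ≫ E'.π := by
  obtain ⟨x0, hx0⟩ := hE.exact_ι.exists_extension hFrob (hP _)
    (f.φ ⟨0, Nat.succ_pos _⟩ - h₀ ≫ E'.ι)
    (by rw [Preadditive.comp_sub, f.comm_ι, ← Category.assoc, hu, sub_self])
  obtain ⟨h, hh0, hP, hR⟩ := exists_chain (n := r + 1)
    (F := fun i hi => E.Y ⟨i + 1, Nat.succ_lt_succ hi⟩ ⟶ E'.Y ⟨i, Nat.lt_succ_of_lt hi⟩)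
    (fun i hi x => (f.φ ⟨i, Nat.lt_succ_of_lt hi⟩ - E.d i hi ≫ x) ≫ E'.d i hi = 0)
    (fun i hi x y => f.φ ⟨i + 1, Nat.lt_succ_of_lt hi⟩ =
      E.d (i + 1) hi ≫ y + x ≫ E'.d i (Nat.lt_of_succ_lt hi))
    (Nat.succ_pos _) x0
    (by rw [hx0, sub_sub_cancel, Category.assoc, hE'.exact_ι.comp_eq_zero, comp_zero])
    (by
      intro i hi x hx
      obtain ⟨y, hy⟩ := (hE.exact_d i (Nat.lt_of_succ_lt_succ hi)).exists_extension hFrob (hP _)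
        (f.φ ⟨i + 1, Nat.lt_succ_of_lt hi⟩ - x ≫ E'.d i (Nat.lt_of_succ_lt hi))
        (by rw [Preadditive.comp_sub, f.comm_d, ← Category.assoc, ← Preadditive.sub_comp, hx])
      refine ⟨y, ?_, by rw [hy, sub_add_cancel]⟩
      rw [hy, sub_sub_cancel, Category.assoc,
        (hE'.exact_d i (Nat.lt_of_succ_lt_succ hi)).comp_eq_zero, comp_zero])
  obtain ⟨g, hg⟩ := hE.exact_π.exists_desc hFrob hE.surj
    (f.φ ⟨r + 1, Nat.lt_succ_self _⟩ - h r (Nat.lt_succ_self _) ≫ E'.d r (Nat.lt_succ_self _))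
    (by rw [Preadditive.comp_sub, f.comm_d, ← Category.assoc, ← Preadditive.sub_comp,
      hP r (Nat.lt_succ_self _)])
  refine ⟨h, g, by rw [hh0, hx0, add_sub_cancel], fun i hi => hR i (Nat.succ_lt_succ hi),
    by rw [hg, sub_add_cancel], ?_⟩
  have := hE.surj.epi
  rw [← cancel_epi E.π, f.comm_π, ← Category.assoc, hg, Preadditive.sub_comp, Category.assoc,
    hE'.exact_π.comp_eq_zero, comp_zero, sub_zero]

end LongSeq

/-! ### Stable equality -/

section Stable

variable {A : Type u₁} [Category.{v₁} A] [Preadditive A]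

lemma stableRel.sub {M N : A} {f g : M ⟶ N} (h : stableRel A f g) : stableRel A (f - g) 0 := by
  obtain ⟨P, hP, a, b, hab⟩ := h
  exact ⟨P, hP, a, b, by rw [sub_zero, hab]⟩

lemma stableRel.symm {M N : A} {f g : M ⟶ N} (h : stableRel A f g) : stableRel A g f := by
  obtain ⟨P, hP, a, b, hab⟩ := h
  exact ⟨P, hP, -a, b, by rw [Preadditive.neg_comp, ← hab, neg_sub]⟩

lemma stableRel.comp_left {L M N : A} (e : L ⟶ M) {f g : M ⟶ N} (h : stableRel A f g) :
    stableRel A (e ≫ f) (e ≫ g) := by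
  obtain ⟨P, hP, a, b, hab⟩ := h
  exact ⟨P, hP, e ≫ a, b, by rw [← Preadditive.comp_sub, hab, Category.assoc]⟩

lemma stableRel.comp_right {L M N : A} {f g : L ⟶ M} (e : M ⟶ N) (h : stableRel A f g) :
    stableRel A (f ≫ e) (g ≫ e) := by
  obtain ⟨P, hP, a, b, hab⟩ := h
  exact ⟨P, hP, a, b ≫ e, by rw [← Preadditive.sub_comp, hab, Category.assoc]⟩

lemma stableRel.trans (hA : IsFrobenius A) {M N : A} {f g h : M ⟶ N} (h₁ : stableRel A f g)
    (h₂ : stableRel A g h) : stableRel A f h := by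
  let _ := hA.abelian
  have := Abelian.hasFiniteBiproducts (C := A)
  have : HasBinaryBiproducts A := hasBinaryBiproducts_of_finite_biproducts A
  obtain ⟨P, hP, a, b, hab⟩ := h₁
  obtain ⟨Q, hQ, a', b', hab'⟩ := h₂
  exact ⟨P ⊞ Q, inferInstance, biprod.lift a a', biprod.desc b b', by
    rw [biprod.lift_desc, ← hab, ← hab', sub_add_sub_cancel]⟩

lemma toStable_map_eq_iff (hA : IsFrobenius A) {M N : A} {f g : M ⟶ N} :
    (toStable A).map f = (toStable A).map g ↔ stableRel A f g := by
  have : EnoughProjectives A := hA.enoughProjectives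
  have : Congruence (stableRel A) :=
    { equivalence := ⟨fun f => ⟨Projective.over _, inferInstance, 0, Projective.π _, by simp⟩,
        stableRel.symm, stableRel.trans hA⟩
      comp_left := fun e => stableRel.comp_left e
      comp_right := fun e => stableRel.comp_right e }
  exact Quotient.functor_map_eq_iff _ _ _

end Stable

namespace LongSeq

variable {r : ℕ} {M M' N N' : Mod k C}

/-- The right component of a morphism of sequences is determined, stably, by the left one. -/
lemma Map.stableRel (hFrob : IsFrobenius (Mod k C)) {E : LongSeq r M N} (hE : E.IsExact)
    {E' : LongSeq r M' N'} (hE' : E'.IsExact) (hP : ∀ i, Projective (E'.Y i))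
    {u u' : M ⟶ M'} {α α' : N ⟶ N'} (f : Map E E' u α) (f' : Map E E' u' α')
    (hu : stableRel (Mod k C) u u') : stableRel (Mod k C) α α' := by
  obtain ⟨P, hP', a, b, hab⟩ := hu
  obtain ⟨c, hc⟩ := hE.inj.exists_extension hFrob hP' a
  obtain ⟨-, g, -, -, -, hg⟩ := (f.sub f').exists_homotopy hFrob hE hE' hP (c ≫ b)
    (by rw [← Category.assoc, hc, hab])
  exact ⟨_, hP _, g, E'.π, hg⟩

/-- If the right component of a morphism of sequences is stably the identity, it can be made equal
to the identity. -/
lemma Map.exists_of_stableRel_id {E : LongSeq r M N} (hE : E.IsExact)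
    {E' : LongSeq r M' N} (hE' : E'.IsExact) {u : M ⟶ M'} {α : N ⟶ N} (f : Map E E' u α)
    (hα : NAngle.stableRel (Mod k C) α (𝟙 N)) : Nonempty (Map E E' u (𝟙 N)) := by
  obtain ⟨P, hP, a, b, hab⟩ := hα
  obtain ⟨c, hc⟩ := hE'.surj.exists_lift hP b
  have w : E.d r (Nat.lt_succ_self _) ≫ E.π = 0 := hE.exact_π.comp_eq_zero
  refine ⟨⟨fun i => f.φ i - if hi : i = ⟨r + 1, Nat.lt_succ_self _⟩ then
    eqToHom (by rw [hi]) ≫ E.π ≫ a ≫ c ≫ eqToHom (by rw [hi]) else 0, ?_, ?_, ?_⟩⟩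
  · rw [dif_neg (by simp), sub_zero, f.comm_ι]
  · intro i h
    have hne : (⟨i, Nat.lt_succ_of_lt h⟩ : Fin (r + 2)) ≠ ⟨r + 1, Nat.lt_succ_self _⟩ :=
      fun hi => h.ne (congrArg Fin.val hi)
    rw [dif_neg hne, sub_zero, Preadditive.comp_sub, f.comm_d, sub_eq_self]
    split_ifs with hi
    · obtain rfl : i = r := by simpa using hi
      simp [reassoc_of% w]
    · exact comp_zero
  · rw [dif_pos rfl, Preadditive.sub_comp, ← f.comm_π]
    simp [hc, ← hab]

/-- Two sequences whose comparisons with a third one agree stably admit a morphism with identities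
at both ends. -/
lemma exists_map_id_of_stableRel (hFrob : IsFrobenius (Mod k C)) {E E' : LongSeq r M N}
    (hE : E.IsExact) (hE' : E'.IsExact) (hP' : ∀ i, Projective (E'.Y i))
    {R : LongSeq r M N'} (hR : R.IsExact) {α β : N ⟶ N'}
    (f : Map E R (𝟙 M) α) (g : Map E' R (𝟙 M) β) (h : stableRel (Mod k C) α β) :
    Nonempty (Map E E' (𝟙 M) (𝟙 N)) := by
  obtain ⟨δ, ⟨e⟩⟩ := exists_map hFrob hR hE' hP' (𝟙 M)
  have h1 : NAngle.stableRel (Mod k C) (β ≫ δ) (𝟙 N) :=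
    (g.comp e).stableRel hFrob hE' hE' hP' (Map.id E')
      ⟨_, hP' ⟨0, Nat.succ_pos _⟩, 0, 0, by rw [Category.comp_id, sub_self, comp_zero]⟩
  obtain ⟨m⟩ := (f.comp e).exists_of_stableRel_id hE hE' ((h.comp_right δ).trans hFrob h1)
  rw [Category.comp_id] at m
  exact ⟨m⟩

end LongSeq

lemma Cosyzygies.resolution_isExact (c : Cosyzygies k C) (r : ℕ) (M : Mod k C) :
    (c.resolution r M).IsExact where
  inj := c.inj M
  exact_ι := (c.inj _).exact_comp (c.exact _)
  exact_d _ _ := (c.surj _).comp_exact ((c.inj _).exact_comp (c.exact _))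
  exact_π := (c.surj _).comp_exact (c.exact _)
  surj := c.surj _

end Modules
/-! ### Periodic homotopies -/

section Sequences

variable {D : Type u₁} [Category.{v₁} D] {S : D ⥤ D} {r : ℕ}

lemma NSeq.comp_φ {X Y Z : NSeq S r} (f : X ⟶ Y) (g : Y ⟶ Z) (i : Fin (r + 2)) :
    NSeq.Hom.φ (f ≫ g) i = NSeq.Hom.φ f i ≫ NSeq.Hom.φ g i := rfl

lemma NSeq.id_φ (X : NSeq S r) (i : Fin (r + 2)) : NSeq.Hom.φ (𝟙 X) i = 𝟙 (X.X i) := rfl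

variable [Preadditive D]

lemma Homotopic.symm [S.Additive] {X Y : NSeq S r} {φ ψ : X ⟶ Y} (H : Homotopic φ ψ) :
    Homotopic ψ φ := by
  obtain ⟨h, s, h1, h2, h3⟩ := H
  refine ⟨fun i hi => -h i hi, -s, fun i hi => ?_, ?_, ?_⟩
  · rw [← neg_sub, h1 i hi, Preadditive.comp_neg, Preadditive.neg_comp, neg_add]
  · rw [← neg_sub, h2, Preadditive.comp_neg, Preadditive.neg_comp, neg_add]
  · rw [← neg_sub, S.map_neg, h3, Preadditive.comp_neg, Preadditive.neg_comp, neg_add, S.map_neg]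

lemma Homotopic.trans [S.Additive] {X Y : NSeq S r} {φ ψ χ : X ⟶ Y} (H : Homotopic φ ψ)
    (H' : Homotopic ψ χ) : Homotopic φ χ := by
  obtain ⟨h, s, h1, h2, h3⟩ := H
  obtain ⟨h', s', h1', h2', h3'⟩ := H'
  refine ⟨fun i hi => h i hi + h' i hi, s + s', fun i hi => ?_, ?_, ?_⟩
  · rw [← sub_add_sub_cancel _ (NSeq.Hom.φ ψ _), h1 i hi, h1' i hi, Preadditive.comp_add,
      Preadditive.add_comp, add_add_add_comm]
  · rw [← sub_add_sub_cancel _ (NSeq.Hom.φ ψ _), h2, h2', Preadditive.comp_add,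
      Preadditive.add_comp, add_add_add_comm]
  · rw [← sub_add_sub_cancel _ (NSeq.Hom.φ ψ _), S.map_add, h3, h3', Preadditive.comp_add,
      Preadditive.add_comp, S.map_add, add_add_add_comm]

lemma Homotopic.comp_left {W X Y : NSeq S r} (e : W ⟶ X) {φ ψ : X ⟶ Y} (H : Homotopic φ ψ) :
    Homotopic (e ≫ φ) (e ≫ ψ) := by
  obtain ⟨h, s, h1, h2, h3⟩ := H
  refine ⟨fun i hi => NSeq.Hom.φ e _ ≫ h i hi, S.map (NSeq.Hom.φ e _) ≫ s,
    fun i hi => ?_, ?_, ?_⟩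
  · rw [NSeq.comp_φ, NSeq.comp_φ, ← Preadditive.comp_sub, h1 i hi, Preadditive.comp_add,
      ← Category.assoc, ← NSeq.Hom.comm e, Category.assoc, Category.assoc]
  · rw [NSeq.comp_φ, NSeq.comp_φ, ← Preadditive.comp_sub, h2, Preadditive.comp_add,
      ← Category.assoc, ← NSeq.Hom.comm_last e, Category.assoc, Category.assoc]
  · rw [NSeq.comp_φ, NSeq.comp_φ, ← Preadditive.comp_sub, S.map_comp, h3, Preadditive.comp_add,
      ← S.map_comp, ← Category.assoc, ← NSeq.Hom.comm e, Category.assoc, Category.assoc]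

lemma Homotopic.comp_right {X Y Z : NSeq S r} {φ ψ : X ⟶ Y} (e : Y ⟶ Z) (H : Homotopic φ ψ) :
    Homotopic (φ ≫ e) (ψ ≫ e) := by
  obtain ⟨h, s, h1, h2, h3⟩ := H
  refine ⟨fun i hi => h i hi ≫ NSeq.Hom.φ e _, s ≫ NSeq.Hom.φ e _, fun i hi => ?_, ?_, ?_⟩
  · rw [NSeq.comp_φ, NSeq.comp_φ, ← Preadditive.sub_comp, h1 i hi, Preadditive.add_comp,
      Category.assoc, Category.assoc, Category.assoc, NSeq.Hom.comm e]
  · rw [NSeq.comp_φ, NSeq.comp_φ, ← Preadditive.sub_comp, h2, Preadditive.add_comp,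
      Category.assoc, Category.assoc, Category.assoc, NSeq.Hom.comm e]
  · rw [NSeq.comp_φ, NSeq.comp_φ, ← Preadditive.sub_comp, S.map_comp, h3, Preadditive.add_comp,
      Category.assoc, NSeq.Hom.comm_last e, ← S.map_comp, Category.assoc, Category.assoc]

/-- A morphism with a left and a right inverse up to homotopy is a homotopy equivalence. -/
lemma HomotopyEquivalent.of_left_right [S.Additive] {X Y : NSeq S r} (φ : X ⟶ Y) {ψ ψ' : Y ⟶ X}
    (h : Homotopic (φ ≫ ψ) (𝟙 X)) (h' : Homotopic (ψ' ≫ φ) (𝟙 Y)) : HomotopyEquivalent X Y := by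
  refine ⟨φ, ψ, h, ?_⟩
  have h1 := h'.comp_right ψ
  have h2 := h.comp_left ψ'
  rw [Category.assoc, Category.id_comp] at h1
  rw [Category.comp_id] at h2
  exact ((h1.symm.trans h2).comp_right φ).trans h'

/-- The endomorphism of `X` given by `1 + t` in the last place and by the identity elsewhere. -/
def NSeq.shear (X : NSeq S r)
    (t : X.X ⟨r + 1, Nat.lt_succ_self _⟩ ⟶ X.X ⟨r + 1, Nat.lt_succ_self _⟩)
    (h : X.d r (Nat.lt_succ_self _) ≫ t = 0) (h' : t ≫ X.last = 0) : X ⟶ X where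
  φ i := 𝟙 _ + if hi : i = ⟨r + 1, Nat.lt_succ_self _⟩ then
    eqToHom (by rw [hi]) ≫ t ≫ eqToHom (by rw [hi]) else 0
  comm i hi := by
    have hne : (⟨i, Nat.lt_succ_of_lt hi⟩ : Fin (r + 2)) ≠ ⟨r + 1, Nat.lt_succ_self _⟩ :=
      fun e => hi.ne (congrArg Fin.val e)
    rw [dif_neg hne, add_zero, Category.id_comp, Preadditive.comp_add, Category.comp_id,
      add_eq_left]
    split_ifs with e
    · obtain rfl : i = r := by simpa using e
      simp [h]
    · exact comp_zero
  comm_last := by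
    rw [dif_pos rfl, dif_neg (by simp), add_zero, S.map_id, Category.comp_id, eqToHom_refl,
      Category.comp_id, Category.id_comp, Preadditive.add_comp, h', add_zero,
      Category.id_comp]

lemma NSeq.shear_φ_last (X : NSeq S r)
    (t : X.X ⟨r + 1, Nat.lt_succ_self _⟩ ⟶ X.X ⟨r + 1, Nat.lt_succ_self _⟩)
    (h : X.d r (Nat.lt_succ_self _) ≫ t = 0) (h' : t ≫ X.last = 0) :
    NSeq.Hom.φ (X.shear t h h') ⟨r + 1, Nat.lt_succ_self _⟩ = 𝟙 _ + t := by
  simp [NSeq.shear]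

lemma NSeq.shear_φ_of_lt (X : NSeq S r)
    (t : X.X ⟨r + 1, Nat.lt_succ_self _⟩ ⟶ X.X ⟨r + 1, Nat.lt_succ_self _⟩)
    (h : X.d r (Nat.lt_succ_self _) ≫ t = 0) (h' : t ≫ X.last = 0) (i : ℕ) (hi : i < r + 1) :
    NSeq.Hom.φ (X.shear t h h') ⟨i, Nat.lt_succ_of_lt hi⟩ = 𝟙 _ := by
  have hne : (⟨i, Nat.lt_succ_of_lt hi⟩ : Fin (r + 2)) ≠ ⟨r + 1, Nat.lt_succ_self _⟩ :=
    fun e => hi.ne (congrArg Fin.val e)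
  simp only [NSeq.shear, dif_neg hne, add_zero]

lemma NSeq.shear_comp_shear (X : NSeq S r)
    {t t' : X.X ⟨r + 1, Nat.lt_succ_self _⟩ ⟶ X.X ⟨r + 1, Nat.lt_succ_self _⟩}
    (h : X.d r (Nat.lt_succ_self _) ≫ t = 0) (h' : t ≫ X.last = 0)
    (k : X.d r (Nat.lt_succ_self _) ≫ t' = 0) (k' : t' ≫ X.last = 0)
    (hs : t + t' = 0) (ht : t ≫ t' = 0) : X.shear t h h' ≫ X.shear t' k k' = 𝟙 X := by
  apply NSeq.Hom.ext
  funext ⟨i, hi⟩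
  rw [NSeq.comp_φ, NSeq.id_φ]
  obtain hi' | rfl := Nat.lt_succ_iff_lt_or_eq.1 hi
  · rw [shear_φ_of_lt _ _ _ _ i hi', shear_φ_of_lt _ _ _ _ i hi', Category.comp_id]
  · rw [shear_φ_last, shear_φ_last, Preadditive.add_comp, Preadditive.comp_add,
      Preadditive.comp_add, ht, add_zero, Category.id_comp, Category.id_comp, Category.comp_id,
      add_assoc, add_comm t', hs, add_zero]

/-- An endomorphism that differs from the identity by a square-zero morphism in the last place, up
to homotopy, is invertible up to homotopy. -/
lemma NSeq.exists_homotopy_inverse {X : NSeq S r} (e : X ⟶ X)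
    (t : X.X ⟨r + 1, Nat.lt_succ_self _⟩ ⟶ X.X ⟨r + 1, Nat.lt_succ_self _⟩)
    (p1 : X.d r (Nat.lt_succ_self _) ≫ t = 0) (p2 : t ≫ X.last = 0) (p3 : t ≫ t = 0)
    (h : ∀ (i : ℕ) (hi : i < r + 1),
      X.X ⟨i + 1, Nat.succ_lt_succ hi⟩ ⟶ X.X ⟨i, Nat.lt_succ_of_lt hi⟩)
    (h0 : NSeq.Hom.φ e ⟨0, Nat.succ_pos _⟩ - 𝟙 _ = X.d 0 (Nat.succ_pos _) ≫ h 0 (Nat.succ_pos _))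
    (h1 : ∀ (i : ℕ) (hi : i < r),
      NSeq.Hom.φ e ⟨i + 1, Nat.lt_succ_of_lt (Nat.succ_lt_succ hi)⟩ - 𝟙 _ =
        X.d (i + 1) (Nat.succ_lt_succ hi) ≫ h (i + 1) (Nat.succ_lt_succ hi) +
          h i (Nat.lt_succ_of_lt hi) ≫ X.d i (Nat.lt_succ_of_lt hi))
    (h2 : NSeq.Hom.φ e ⟨r + 1, Nat.lt_succ_self _⟩ - 𝟙 _ =
      t + h r (Nat.lt_succ_self _) ≫ X.d r (Nat.lt_succ_self _)) :
    ∃ e' : X ⟶ X, Homotopic (e ≫ e') (𝟙 X) ∧ Homotopic (e' ≫ e) (𝟙 X) := by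
  have q1 : X.d r (Nat.lt_succ_self _) ≫ (-t) = 0 := by rw [Preadditive.comp_neg, p1, neg_zero]
  have q2 : (-t) ≫ X.last = 0 := by rw [Preadditive.neg_comp, p2, neg_zero]
  have H : Homotopic e (X.shear t p1 p2) := by
    refine ⟨h, 0, fun i hi => ?_, ?_, ?_⟩
    · rw [NSeq.shear_φ_of_lt _ _ _ _ (i + 1) (Nat.succ_lt_succ hi), h1 i hi]
    · rw [NSeq.shear_φ_last, comp_zero, zero_add, ← sub_sub, sub_eq_iff_eq_add', h2]
    · rw [NSeq.shear_φ_of_lt _ _ _ _ 0 (Nat.succ_pos _), zero_comp, add_zero, h0]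
  refine ⟨X.shear _ q1 q2, ?_, ?_⟩
  · rw [← X.shear_comp_shear p1 p2 q1 q2 (add_neg_cancel _)
      (by rw [Preadditive.comp_neg, p3, neg_zero])]
    exact H.comp_right _
  · rw [← X.shear_comp_shear q1 q2 p1 p2 (neg_add_cancel _)
      (by rw [Preadditive.neg_comp, p3, neg_zero])]
    exact H.comp_left _

end Sequences

section Modules

variable {k : Type w} [Field k] {C : Type u} [Category.{v} C] [Preadditive C] [Linear k C]
  {S : C ≌ C} [S.functor.Additive] [S.functor.Linear k] {r : ℕ}

namespace LongSeq

variable {M M' : Mod k C}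

/-- The `n`-`Σ`-sequence obtained by splicing `M ⟶ Y 0 ⟶ ⋯ ⟶ Y (r + 1) ⟶ Σ M` with its
shift. -/
def toNSeq (E : LongSeq r M ((shift S).obj M)) : NSeq (shift (k := k) S) r where
  X := E.Y
  d := E.d
  last := E.π ≫ (shift S).map E.ι

/-- The morphism of spliced sequences given by a morphism of sequences. -/
def Map.toNSeq {E : LongSeq r M ((shift S).obj M)} {E' : LongSeq r M' ((shift S).obj M')}
    {u : M ⟶ M'} {α : (shift S).obj M ⟶ (shift S).obj M'} (f : Map E E' u α)
    (hα : α = (shift S).map u) : E.toNSeq ⟶ E'.toNSeq where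
  φ := f.φ
  comm := f.comm_d
  comm_last := by
    change (E.π ≫ (shift S).map E.ι) ≫ (shift S).map (f.φ ⟨0, Nat.succ_pos _⟩) =
      f.φ ⟨r + 1, Nat.lt_succ_self _⟩ ≫ E'.π ≫ (shift S).map E'.ι
    rw [Category.assoc, ← Functor.map_comp, f.comm_ι, Functor.map_comp, ← Category.assoc, ← hα,
      f.comm_π, Category.assoc]

/-- An endomorphism with identities at both ends is invertible up to periodic homotopy. -/
lemma Map.exists_homotopy_inverse (hFrob : IsFrobenius (Mod k C))
    {E : LongSeq r M ((shift S).obj M)} (hE : E.IsExact) (hP : ∀ i, Projective (E.Y i))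
    {u : M ⟶ M} {α : (shift S).obj M ⟶ (shift S).obj M} (f : Map E E u α)
    (hα : α = (shift S).map u) (hu : u = 𝟙 M) : ∃ e' : E.toNSeq ⟶ E.toNSeq,
      Homotopic (f.toNSeq hα ≫ e') (𝟙 E.toNSeq) ∧
        Homotopic (e' ≫ f.toNSeq hα) (𝟙 E.toNSeq) := by
  obtain ⟨h, g, h0, h1, h2, h3⟩ := (f.sub (Map.id E)).exists_homotopy hFrob hE hE hP 0
    (by rw [comp_zero, hu, sub_self])
  rw [zero_comp, zero_add] at h0
  rw [hα, hu, (shift S).map_id, sub_self] at h3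
  have p : (E.π ≫ g) ≫ E.π = 0 := by rw [Category.assoc, ← h3, comp_zero]
  have p' : (E.π ≫ g) ≫ E.π ≫ g = 0 := by rw [← Category.assoc, p, zero_comp]
  refine NSeq.exists_homotopy_inverse (f.toNSeq hα) (E.π ≫ g) ?_ ?_ p' h h0 h1 h2
  · change E.d r (Nat.lt_succ_self _) ≫ (E.π ≫ g) = 0
    rw [← Category.assoc, hE.exact_π.comp_eq_zero, zero_comp]
  · change (E.π ≫ g) ≫ E.π ≫ (shift S).map E.ι = 0
    rw [← Category.assoc, p, zero_comp]

lemma homotopyEquivalent_toNSeq (hFrob : IsFrobenius (Mod k C))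
    {E E' : LongSeq r M ((shift S).obj M)} (hE : E.IsExact) (hE' : E'.IsExact)
    (hP : ∀ i, Projective (E.Y i)) (hP' : ∀ i, Projective (E'.Y i))
    (f : Map E E' (𝟙 M) (𝟙 _)) (g : Map E' E (𝟙 M) (𝟙 _)) :
    HomotopyEquivalent E.toNSeq E'.toNSeq := by
  have hid : 𝟙 ((shift S).obj M) = (shift S).map (𝟙 M) := ((shift S).map_id M).symm
  have hid' : 𝟙 ((shift S).obj M) ≫ 𝟙 _ = (shift S).map (𝟙 M ≫ 𝟙 M) := by
    rw [Category.comp_id, Category.comp_id, hid]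
  obtain ⟨a, ha, -⟩ :=
    Map.exists_homotopy_inverse hFrob hE hP (f.comp g) hid' (Category.comp_id _)
  obtain ⟨b, -, hb⟩ :=
    Map.exists_homotopy_inverse hFrob hE' hP' (g.comp f) hid' (Category.comp_id _)
  exact HomotopyEquivalent.of_left_right (f.toNSeq hid) (ψ := g.toNSeq hid ≫ a)
    (ψ' := b ≫ g.toNSeq hid) ha hb

end LongSeq

end Modules
section Modules

variable {k : Type w} [Field k] {C : Type u} [Category.{v} C] [Preadditive C] [Linear k C]

/-! ### Exact sequences from `n`-`Σ`-complexes -/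

lemma HomExact.yon {X Y Z : C} {f : X ⟶ Y} {g : Y ⟶ Z} (h : HomExact f g) :
    Exact ((yon k C).map f) ((yon k C).map g) :=
  fun W => h (unop W)

lemma surj_of_isIso {M N : Mod k C} (e : M ⟶ N) [IsIso e] : Surj e := fun W y =>
  ⟨((inv e).hom.app W).hom y, by rw [← comp_app_apply, IsIso.inv_hom_id]; rfl⟩

lemma Exact.comp_of_comm {L M N M' N' : Mod k C} {f : L ⟶ M} {g : M ⟶ N} (h : Exact f g)
    {e : M ⟶ M'} {e' : N ⟶ N'} {g' : M' ⟶ N'} (he : Surj e) (he' : Inj e')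
    (w : g ≫ e' = e ≫ g') : Exact (f ≫ e) g' := by
  intro W y
  constructor
  · intro hy
    obtain ⟨x, rfl⟩ := he W y
    obtain ⟨z, rfl⟩ := (h W x).1 (he' W (by
      rw [← comp_app_apply, w, comp_app_apply, hy, map_zero]))
    exact ⟨z, rfl⟩
  · rintro ⟨z, rfl⟩
    rw [← comp_app_apply, Category.assoc, ← w, ← Category.assoc, h.comp_eq_zero, zero_comp,
      zero_app_apply]

variable {S : C ≌ C} [S.functor.Additive] [S.functor.Linear k] {r : ℕ}

lemma exact_toMod_last {X : NSeq S.functor r} (hX : NSeq.exact X) :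
    Exact ((toMod k X).d r (Nat.lt_succ_self _)) (toMod k X).last :=
  (inj_of_mono ((yonShift S).hom.app _)).exact_comp hX.2.1.yon

lemma exact_toMod_last_shift {X : NSeq S.functor r} (hX : NSeq.exact X) :
    Exact (toMod k X).last ((shift S).map ((toMod k X).d 0 (Nat.succ_pos _))) :=
  (HomExact.yon (k := k) hX.2.2).comp_of_comm (surj_of_isIso ((yonShift S).hom.app _))
    (inj_of_mono ((yonShift S).hom.app _)) ((yonShift S).hom.naturality _)

lemma kerSeq_isExact {X : NSeq S.functor r} (hX : NSeq.exact X) {M : Mod k C}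
    {l : M ⟶ (toMod k X).X ⟨0, Nat.succ_pos _⟩}
    {π : (toMod k X).X ⟨r + 1, Nat.lt_succ_self _⟩ ⟶ (shift S).obj M}
    (hl : Inj l) (hl' : Exact l ((toMod k X).d 0 (Nat.succ_pos _)))
    (hπ : π ≫ (shift S).map l = (toMod k X).last) : (kerSeq X l π).IsExact where
  inj := hl
  exact_ι := hl'
  exact_d i h := (hX.1 i h).yon
  exact_π := Exact.of_comp_inj hl.shift_map (by
    change Exact ((toMod k X).d r (Nat.lt_succ_self _)) (π ≫ (shift S).map l)
    rw [hπ]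
    exact exact_toMod_last hX)
  surj := surj_of_exact_of_exact hl.shift_map hl'.shift_map.comp_eq_zero (by
    change Exact (π ≫ (shift S).map l) _
    rw [hπ]
    exact exact_toMod_last_shift hX)

lemma toMod_eq_toNSeq {X : NSeq S.functor r} {M : Mod k C}
    {l : M ⟶ (toMod k X).X ⟨0, Nat.succ_pos _⟩}
    {π : (toMod k X).X ⟨r + 1, Nat.lt_succ_self _⟩ ⟶ (shift S).obj M}
    (hπ : π ≫ (shift S).map l = (toMod k X).last) : toMod k X = (kerSeq X l π).toNSeq := by
  change (⟨(toMod k X).X, (toMod k X).d, (toMod k X).last⟩ : NSeq (shift S) r) =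
    ⟨(toMod k X).X, (toMod k X).d, π ≫ (shift S).map l⟩
  rw [hπ]

lemma projective_toMod [HasFiniteBiproducts C] (X : NSeq S.functor r) (i : Fin (r + 2)) :
    Projective ((toMod k X).X i) :=
  projective_yon (X.X i)

/-- The morphism of sequences obtained from the naturality of the functor sequence. -/
def FunctorSeq.evalMap (T : FunctorSeq (k := k) S r) {M N : Mod k C} (b : M ⟶ N) :
    LongSeq.Map (T.eval M) (T.eval N) b ((shift S).map b) where
  φ i := (T.X i).map b
  comm_ι := (T.ι.naturality b).symm
  comm_d i h := ((T.d i h).naturality b).symm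
  comm_π := (T.π.naturality b).symm

namespace LongSeq

/-- A morphism of spliced exact sequences comes from a morphism of exact sequences. -/
lemma exists_map_of_hom (hFrob : IsFrobenius (Mod k C)) {M M' : Mod k C}
    {E : LongSeq r M ((shift S).obj M)} {E' : LongSeq r M' ((shift S).obj M')}
    (hE : E.IsExact) (hE' : E'.IsExact) (f : E.toNSeq ⟶ E'.toNSeq) :
    ∃ (u : M ⟶ M') (m : Map E E' u ((shift S).map u)), m.φ = NSeq.Hom.φ f := by
  have hd : E.d 0 (Nat.succ_pos _) ≫ NSeq.Hom.φ f ⟨1, Nat.succ_lt_succ (Nat.succ_pos _)⟩ =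
    NSeq.Hom.φ f ⟨0, Nat.succ_pos _⟩ ≫ E'.d 0 (Nat.succ_pos _) := NSeq.Hom.comm f 0 _
  have hlast : (E.π ≫ (shift S).map E.ι) ≫ (shift S).map (NSeq.Hom.φ f ⟨0, Nat.succ_pos _⟩) =
    NSeq.Hom.φ f ⟨r + 1, Nat.lt_succ_self _⟩ ≫ E'.π ≫ (shift S).map E'.ι :=
      NSeq.Hom.comm_last f
  obtain ⟨u, hu⟩ := hE'.exact_ι.exists_lift_of_inj hFrob hE'.inj
    (E.ι ≫ (show E.Y ⟨0, Nat.succ_pos _⟩ ⟶ E'.Y ⟨0, Nat.succ_pos _⟩ from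
      NSeq.Hom.φ f ⟨0, Nat.succ_pos _⟩))
    (by
      have := congrArg (fun e => E.ι ≫ e) hd
      have w := hE.exact_ι.comp_eq_zero
      refine (Category.assoc _ _ _).trans (this.symm.trans ?_)
      exact (Category.assoc _ _ _).symm.trans ((congrArg (fun e => e ≫ _) w).trans zero_comp))
  refine ⟨u, ⟨NSeq.Hom.φ f, hu.symm, NSeq.Hom.comm f, ?_⟩, rfl⟩
  have := (hE'.inj.shift_map (S := S)).mono
  rw [← cancel_mono ((shift S).map E'.ι), Category.assoc, ← Functor.map_comp, hu,
    Functor.map_comp]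
  refine (Category.assoc _ _ _).symm.trans (hlast.trans (Category.assoc _ _ _).symm)

/-- If an endomorphism of a spliced sequence is homotopic to the identity, then the shift of its
left component differs from the identity by a morphism through the last term. -/
lemma Map.shift_map_sub_id_of_homotopic {M : Mod k C} {E : LongSeq r M ((shift S).obj M)}
    (hE : E.IsExact) {u : M ⟶ M} {α : (shift S).obj M ⟶ (shift S).obj M} (m : Map E E u α)
    (e : E.toNSeq ⟶ E.toNSeq) (he : NSeq.Hom.φ e = m.φ) (H : Homotopic e (𝟙 E.toNSeq)) :
    ∃ s : (shift S).obj M ⟶ E.Y ⟨r + 1, Nat.lt_succ_self _⟩,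
      (shift S).map (u - 𝟙 M) = s ≫ E.π := by
  obtain ⟨h, s, h3⟩ : ∃ (h : E.Y ⟨0 + 1, Nat.succ_lt_succ (Nat.succ_pos _)⟩ ⟶
        E.Y ⟨0, Nat.succ_pos _⟩)
      (s : (shift S).obj (E.Y ⟨0, Nat.succ_pos _⟩) ⟶ E.Y ⟨r + 1, Nat.lt_succ_self _⟩),
      (shift S).map (m.φ ⟨0, Nat.succ_pos _⟩ - 𝟙 _) =
        (shift S).map (E.d 0 (Nat.succ_pos _) ≫ h) + s ≫ E.π ≫ (shift S).map E.ι := by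
    obtain ⟨h, s, -, -, h3⟩ := H
    rw [he] at h3
    exact ⟨h 0 (Nat.succ_pos _), s, h3⟩
  refine ⟨(shift S).map E.ι ≫ s, ?_⟩
  have := (hE.inj.shift_map (S := S)).mono
  rw [← cancel_mono ((shift S).map E.ι), ← Functor.map_comp, Preadditive.sub_comp,
    Category.id_comp, ← m.comm_ι]
  have e1 : E.ι ≫ m.φ ⟨0, Nat.succ_pos _⟩ - E.ι = E.ι ≫ (m.φ ⟨0, Nat.succ_pos _⟩ - 𝟙 _) := by
    rw [Preadditive.comp_sub, Category.comp_id]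
  have e2 : (shift S).map E.ι ≫ (shift S).map (E.d 0 (Nat.succ_pos _) ≫ h) = 0 := by
    rw [← Functor.map_comp, ← Category.assoc, hE.exact_ι.comp_eq_zero, zero_comp,
      Functor.map_zero]
  rw [e1, Functor.map_comp, h3, Preadditive.comp_add, e2, zero_add]
  simp only [Category.assoc]

end LongSeq

/-! ### The characterization -/

variable [HasFiniteBiproducts C]

lemma htpyStandard_of_phi (hFrob : IsFrobenius (Mod k C)) {T : FunctorSeq (k := k) S r}
    {c : Cosyzygies k C} {X : NComplex S.functor r} (hX : Phi c T X) : HtpyStandard T X := by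
  obtain ⟨M, l, π, hl, hl', hπ, α, β, hα, hβ, h⟩ := hX
  obtain ⟨a⟩ := LongSeq.isComparison_iff.1 hα
  obtain ⟨b⟩ := LongSeq.isComparison_iff.1 hβ
  have hst := (toStable_map_eq_iff hFrob).1 h
  have hE := kerSeq_isExact X.property hl hl' hπ
  have hR := c.resolution_isExact r M
  obtain ⟨f⟩ := LongSeq.exists_map_id_of_stableRel hFrob hE (T.exact M)
    (fun i => T.projective i M) hR b a hst
  obtain ⟨g⟩ := LongSeq.exists_map_id_of_stableRel hFrob (T.exact M) hE
    (projective_toMod X.obj) hR a b hst.symm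
  refine ⟨M, ?_⟩
  rw [toMod_eq_toNSeq hπ]
  exact LongSeq.homotopyEquivalent_toNSeq hFrob hE (T.exact M) (projective_toMod X.obj)
    (fun i => T.projective i M) f g

lemma phi_of_htpyStandard (hFrob : IsFrobenius (Mod k C)) {T : FunctorSeq (k := k) S r}
    (c : Cosyzygies k C) {X : NComplex S.functor r} (hX : HtpyStandard T X) : Phi c T X := by
  obtain ⟨M, hM⟩ := hX
  obtain ⟨K, l, hl, hl'⟩ := exists_inj_exact hFrob ((toMod k X.obj).d 0 (Nat.succ_pos _))
  obtain ⟨π, hπ⟩ := (hl'.shift_map (S := S)).exists_lift_of_inj hFrob hl.shift_map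
    (toMod k X.obj).last (exact_toMod_last_shift X.property).comp_eq_zero
  have hE := kerSeq_isExact X.property hl hl' hπ
  have hR := c.resolution_isExact r K
  have hRP : ∀ i, Projective ((c.resolution r K).Y i) := fun i => c.projective _
  obtain ⟨α, ⟨a⟩⟩ := LongSeq.exists_map hFrob (E := T.eval K) (T.exact K) hR hRP (𝟙 K)
  obtain ⟨β, ⟨b⟩⟩ := LongSeq.exists_map hFrob hE hR hRP (𝟙 K)
  refine ⟨K, l, π, hl, hl', hπ, α, β, LongSeq.isComparison_iff.2 ⟨a⟩,
    LongSeq.isComparison_iff.2 ⟨b⟩, (toStable_map_eq_iff hFrob).2 ?_⟩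
  rw [toMod_eq_toNSeq hπ] at hM
  obtain ⟨φ, ψ, H, -⟩ := hM
  obtain ⟨p, f, hf⟩ := LongSeq.exists_map_of_hom hFrob hE (E' := T.eval M) (T.exact M) φ
  obtain ⟨q, g, hg⟩ := LongSeq.exists_map_of_hom hFrob (E := T.eval M) (T.exact M) hE ψ
  obtain ⟨s, hs⟩ := (f.comp g).shift_map_sub_id_of_homotopic hE (φ ≫ ψ)
    (by change _ = fun i => f.φ i ≫ g.φ i; rw [hf, hg]; rfl) H
  obtain ⟨P, hP, a', b', hab⟩ := exists_factorization_of_shift (p ≫ q - 𝟙 K) _ s _ hs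
  have h1 : stableRel (Mod k C) β (((shift S).map p ≫ (shift S).map q) ≫ α) := by
    refine LongSeq.Map.stableRel hFrob hE hR hRP b ((f.comp (T.evalMap q)).comp a)
      (stableRel.symm ⟨P, hP, a', b', ?_⟩)
    rw [Category.comp_id, hab]
  refine h1.trans hFrob ?_
  refine ⟨_, projective_toMod X.obj _, s, (kerSeq X.obj l π).π ≫ α, ?_⟩
  refine Eq.trans ?_ ((congrArg (fun x => x ≫ α) hs).trans (Category.assoc _ _ _))
  rw [Functor.map_sub, CategoryTheory.Functor.map_id, Preadditive.sub_comp,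
    Category.id_comp, Functor.map_comp]

end Modules
end NAngle

theorem proposition2p5
    {k : Type w} [Field k] [IsAlgClosed k]
    {C : Type u} [Category.{v} C] [Preadditive C] [Linear k C] [HasFiniteBiproducts C]
    [IsIdempotentComplete C]
    (S : C ≌ C) [S.functor.Additive] [S.functor.Linear k]
    (hFrob : NAngle.IsFrobenius (NAngle.Mod k C))
    (r : ℕ) (hr : 1 ≤ r)
    (T : NAngle.FunctorSeq (k := k) S r)
    (c : NAngle.Cosyzygies k C) :
    (∀ X : NAngle.NComplex S.functor r, NAngle.Phi c T X ↔ NAngle.HtpyStandard T X) ∧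
    ∃ e : (NAngle.Phi c T).FullSubcategory ≌ (NAngle.HtpyStandard T).FullSubcategory,
      Nonempty (e.functor ⋙ (NAngle.HtpyStandard T).ι ≅ (NAngle.Phi c T).ι) := by
  have h : ∀ X : NAngle.NComplex S.functor r, NAngle.Phi c T X ↔ NAngle.HtpyStandard T X :=
    fun X => ⟨NAngle.htpyStandard_of_phi hFrob, NAngle.phi_of_htpyStandard hFrob c⟩
  refine ⟨h, ?_⟩
  rw [show NAngle.HtpyStandard T = NAngle.Phi c T from funext fun X => propext (h X).symm]
  exact ⟨CategoryTheory.Equivalence.refl, ⟨Functor.leftUnitor _⟩⟩
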